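/- All graphs are finite and simple, and $|G|$ denotes the number of vertices of $G$. A configuration on a graph $G$ places a finite number of pebbles on the vertices of $G$ (several pebbles may share a vertex); its size is the total number of pebbles. A pebbling move removes two pebbles from a vertex and places one pebble on an adjacent vertex. The pebbling number $\pi(G)$ of a connected graph $G$ is the least $n$ such that, for every vertex $r$ of $G$ and every configuration of size $n$ on $G$, some finite (possibly empty) sequence of pebbling moves leads to a configuration with at least one pebble on $r$. The strong product $G \boxtimes H$ is the graph on $V(G) \times V(H)$ in which $(g,h)$ and $(g',h')$ are adjacent if and only if one of the following holds: $g = g'$ and $h \sim_H h'$; or $h = h'$ and $g \sim_G g'$; or $g \sim_G g'$ and $h \sim_H h'$. **Proposition.** Let $G$ and $H$ be connected graphs. Then $$\pi(G \boxtimes H) \le \tfrac12\,\bigl(\pi(G) + 2|G| + 1\bigr)\bigl(\pi(H) + 1\bigr).$$ -/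

import Mathlib

namespace Pebbling

universe u v

/-- The strong product `G ⊠ H` of two simple graphs. -/
def strongProd {V : Type u} {W : Type v} (G : SimpleGraph V) (H : SimpleGraph W) :
    SimpleGraph (V × W) where
  Adj x y :=
    (x.1 = y.1 ∧ H.Adj x.2 y.2) ∨
    (x.2 = y.2 ∧ G.Adj x.1 y.1) ∨
    (G.Adj x.1 y.1 ∧ H.Adj x.2 y.2)
  symm := ⟨by
    rintro x y (⟨h₁, h₂⟩ | ⟨h₁, h₂⟩ | ⟨h₁, h₂⟩)
    · exact Or.inl ⟨h₁.symm, h₂.symm⟩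
    · exact Or.inr (Or.inl ⟨h₁.symm, h₂.symm⟩)
    · exact Or.inr (Or.inr ⟨h₁.symm, h₂.symm⟩)⟩
  loopless := ⟨by
    rintro x (⟨_, h⟩ | ⟨_, h⟩ | ⟨h, _⟩)
    · exact H.loopless.irrefl _ h
    · exact G.loopless.irrefl _ h
    · exact G.loopless.irrefl _ h⟩

/-- A configuration of pebbles on the vertex set `V`: a finite multiset of vertices, in which the
multiplicity of a vertex is the number of pebbles placed on it. The size of the configuration is
its cardinality `Multiset.card`. -/
abbrev Config (V : Type u) : Type u := Multiset V

/-- `Move G C D`: the configuration `D` arises from `C` by one pebbling move, which removes two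
pebbles from a vertex `a` and puts one pebble on a neighbour `b` of `a`; the remaining pebbles `E`
do not move. -/
def Move {V : Type u} (G : SimpleGraph V) (C D : Config V) : Prop :=
  ∃ (a b : V) (E : Config V), G.Adj a b ∧ C = E + {a, a} ∧ D = E + {b}

/-- `Reach G C D`: `D` arises from `C` by a finite, possibly empty, sequence of pebbling moves. -/
def Reach {V : Type u} (G : SimpleGraph V) : Config V → Config V → Prop :=
  Relation.ReflTransGen (Move G)

/-- `C` is `r`-solvable: some sequence of pebbling moves puts a pebble on the root `r`. -/
def Solvable {V : Type u} (G : SimpleGraph V) (r : V) (C : Config V) : Prop :=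
  ∃ D : Config V, Reach G C D ∧ r ∈ D

/-- `n` pebbles suffice: every configuration of size `n` is `r`-solvable for every root `r`. -/
def Suffices {V : Type u} (G : SimpleGraph V) (n : ℕ) : Prop :=
  ∀ (r : V) (C : Config V), Multiset.card C = n → Solvable G r C

/-- The pebbling number `π(G)`: the least number of pebbles that suffices. By
`isLeast_pebblingNumber` below, this minimum exists if `G` is finite and connected. -/
noncomputable def pebblingNumber {V : Type u} (G : SimpleGraph V) : ℕ :=
  sInf {n : ℕ | Suffices G n}

/-! The pebbling number of a finite connected graph is a genuine minimum. -/

theorem Reach.add_right {V : Type u} {G : SimpleGraph V} {C D : Config V} (h : Reach G C D)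
    (E : Config V) : Reach G (C + E) (D + E) := by
  induction h with
  | refl => exact Relation.ReflTransGen.refl
  | tail _ hm ih =>
    obtain ⟨a, b, F, hab, rfl, rfl⟩ := hm
    exact ih.tail ⟨a, b, F + E, hab, add_right_comm _ _ _, add_right_comm _ _ _⟩

theorem Solvable.mono {V : Type u} {G : SimpleGraph V} {r : V} {C C' : Config V}
    (h : Solvable G r C) (hC : C ≤ C') : Solvable G r C' := by
  obtain ⟨E, rfl⟩ := Multiset.le_iff_exists_add.mp hC
  obtain ⟨D, hD, hr⟩ := h
  exact ⟨D + E, hD.add_right E, Multiset.mem_add.mpr (Or.inl hr)⟩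

theorem reach_replicate_of_adj {V : Type u} {G : SimpleGraph V} {a b : V} (hab : G.Adj a b)
    (m : ℕ) : Reach G (Multiset.replicate (2 * m) a) (Multiset.replicate m b) := by
  induction m with
  | zero => exact Relation.ReflTransGen.refl
  | succ m ih =>
    have h₁ := ih.add_right {a, a}
    have h₂ : Move G (Multiset.replicate m b + {a, a}) (Multiset.replicate m b + {b}) :=
      ⟨a, b, _, hab, rfl, rfl⟩
    have h₃ : Multiset.replicate (2 * (m + 1)) a
        = Multiset.replicate (2 * m) a + {a, a} := by
      rw [Nat.mul_succ, Multiset.replicate_add]; rfl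
    have h₄ : Multiset.replicate (m + 1) b = Multiset.replicate m b + {b} := by
      rw [Multiset.replicate_add]; rfl
    rw [h₃, h₄]
    exact Relation.ReflTransGen.tail h₁ h₂

theorem solvable_replicate_of_walk {V : Type u} {G : SimpleGraph V} {a r : V} (p : G.Walk a r) :
    Solvable G r (Multiset.replicate (2 ^ p.length) a) := by
  induction p with
  | nil => exact ⟨_, Relation.ReflTransGen.refl, Multiset.mem_replicate.mpr ⟨one_ne_zero, rfl⟩⟩
  | cons h p ih =>
    obtain ⟨D, hD, hr⟩ := ih
    refine ⟨D, Relation.ReflTransGen.trans ?_ hD, hr⟩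
    rw [SimpleGraph.Walk.length_cons, pow_succ, mul_comm]
    exact reach_replicate_of_adj h _

theorem exists_suffices {V : Type u} [Fintype V] {G : SimpleGraph V} (hG : G.Connected) :
    ∃ n : ℕ, Suffices G n := by
  classical
  refine ⟨Fintype.card V * 2 ^ Fintype.card V, fun r C hC => ?_⟩
  have hne : Nonempty V := hG.nonempty
  obtain ⟨a, -, ha⟩ : ∃ a ∈ (Finset.univ : Finset V), 2 ^ Fintype.card V ≤ C.count a := by
    refine Finset.exists_le_of_sum_le Finset.univ_nonempty ?_
    rw [Finset.sum_const, smul_eq_mul, Finset.card_univ, ← hC,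
      Multiset.sum_count_eq_card (fun x _ => Finset.mem_univ x)]
  obtain ⟨p, hp⟩ := (hG.preconnected a r).exists_isPath
  refine (solvable_replicate_of_walk p).mono (Multiset.le_count_iff_replicate_le.mp ?_)
  exact (Nat.pow_le_pow_right two_pos hp.length_lt.le).trans ha

theorem isLeast_pebblingNumber {V : Type u} [Fintype V] {G : SimpleGraph V}
    (hG : G.Connected) : IsLeast {n : ℕ | Suffices G n} (pebblingNumber G) :=
  ⟨Nat.sInf_mem (exists_suffices hG), fun _ hn => Nat.sInf_le hn⟩

theorem strongProd_connected {V : Type u} {W : Type v} {G : SimpleGraph V} {H : SimpleGraph W}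
    (hG : G.Connected) (hH : H.Connected) : (strongProd G H).Connected := by
  refine (hG.boxProd hH).mono fun x y h => ?_
  rcases SimpleGraph.boxProd_adj.mp h with ⟨h₁, h₂⟩ | ⟨h₁, h₂⟩
  · exact Or.inr (Or.inl ⟨h₂, h₁⟩)
  · exact Or.inl ⟨h₂, h₁⟩

end Pebbling

namespace Pebbling

universe u v

variable {V : Type u} {W : Type v} {G : SimpleGraph V} {H : SimpleGraph W}

/-! Let m and n suffice for G and H. Cut the pebbles over each vertex g of G into blocks of n + 1;
at most n per fibre are left over. A block over g is worth two pebbles on g: within its fibre it can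
bring two pebbles to the copy of the target s or next to it, and one strong-product move then yields
a pebble on (g', s) for any neighbour g' of g (`Suffices.fiber_reach_adj`). Hence a solution in G
started from two pebbles per block lifts to the product (`Represents.move`), and counting
(`exists_blocks`) gives at least m such pebbles. -/

theorem exists_le_card_eq {α : Type*} {n : ℕ} {C : Multiset α} (h : n ≤ Multiset.card C) :
    ∃ D ≤ C, Multiset.card D = n := by
  induction C using Quotient.inductionOn with
  | _ l => exact ⟨(l.take n : List α), (List.take_sublist n l).subperm, by simpa using h⟩

theorem Suffices.solvable {n : ℕ} (h : Suffices G n) (r : V) {C : Config V}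
    (hC : n ≤ Multiset.card C) : Solvable G r C := by
  obtain ⟨D, hD, hn⟩ := exists_le_card_eq hC
  exact (h r D hn).mono hD

/-- Pebbling moves in `H` can be carried out in any fibre of the strong product. -/
theorem Reach.fiber {C D : Config W} (h : Reach H C D) (g : V) :
    Reach (strongProd G H) (C.map (Prod.mk g)) (D.map (Prod.mk g)) := by
  induction h with
  | refl => exact Relation.ReflTransGen.refl
  | tail _ hm ih =>
    obtain ⟨a, b, E, hab, rfl, rfl⟩ := hm
    refine ih.tail ⟨(g, a), (g, b), E.map (Prod.mk g), Or.inl ⟨rfl, hab⟩, ?_, ?_⟩ <;> simp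

/-- If pebbles reach a vertex `s` that was empty, a neighbour of `s` once had two pebbles. -/
theorem Reach.exists_adj_pair {C D : Config W} {s : W} (h : Reach H C D) (hs : s ∈ D)
    (hC : s ∉ C) : ∃ (a : W) (E : Config W), H.Adj a s ∧ Reach H C (E + {a, a}) := by
  induction h with
  | refl => exact absurd hs hC
  | tail hr hm ih =>
    obtain ⟨a, b, E, hab, rfl, rfl⟩ := hm
    rcases Multiset.mem_add.mp hs with hE | hb
    · exact ih (Multiset.mem_add.mpr (Or.inl hE))
    · rw [Multiset.mem_singleton.mp hb]
      exact ⟨a, E, hab, hr⟩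

/-- One pebble more than suffices brings two pebbles to `s` or to a neighbour of `s`. -/
theorem Suffices.exists_pair {n : ℕ} (h : Suffices H n) (s : W) {M : Config W}
    (hM : Multiset.card M = n + 1) :
    ∃ (a : W) (E : Config W), (a = s ∨ H.Adj a s) ∧ Reach H M (E + {a, a}) := by
  -- If s is occupied, one pebble waits there while the other n bring a second. Otherwise stop just
  -- before the first pebble arrives at s.
  by_cases hs : s ∈ M
  · obtain ⟨M', rfl⟩ := Multiset.exists_cons_of_mem hs
    obtain ⟨D, hD, hsD⟩ := h s M' (by simpa using hM)
    obtain ⟨E, rfl⟩ := Multiset.exists_cons_of_mem hsD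
    refine ⟨s, E, Or.inl rfl, ?_⟩
    have h₁ := hD.add_right {s}
    have h₂ : s ::ₘ M' = M' + {s} := by rw [Multiset.add_comm, Multiset.singleton_add]
    have h₃ : E + {s, s} = s ::ₘ E + {s} := by
      simp [Multiset.insert_eq_cons]
    rwa [h₂, h₃]
  · obtain ⟨D, hD, hsD⟩ := h.solvable s (C := M) (by omega)
    obtain ⟨a, E, ha, hr⟩ := hD.exists_adj_pair hsD hs
    exact ⟨a, E, Or.inr ha, hr⟩

/-- One pebble more than suffices in `H`, placed on the fibre over `g`, can be moved to the copy
of `s` in the fibre over any neighbour `g'` of `g`. -/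
theorem Suffices.fiber_reach_adj {n : ℕ} (h : Suffices H n) (s : W) {M : Config W}
    (hM : Multiset.card M = n + 1) {g g' : V} (hg : G.Adj g g') :
    ∃ F, Reach (strongProd G H) (M.map (Prod.mk g)) ({(g', s)} + F) := by
  obtain ⟨a, E, ha, hr⟩ := h.exists_pair s hM
  refine ⟨E.map (Prod.mk g), (hr.fiber g).tail
    ⟨(g, a), (g', s), E.map (Prod.mk g), ?_, by simp, Multiset.add_comm _ _⟩⟩
  rcases ha with rfl | ha
  · exact Or.inr (Or.inl ⟨rfl, hg⟩)
  -- The diagonal edges of the strong product are what let the move change fibre and reach s at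
  -- once.
  · exact Or.inr (Or.inr ⟨hg, ha⟩)

/-- The configuration on the product formed by a family of configurations on fibres. -/
def blocks (K : Multiset (V × Config W)) : Config (V × W) :=
  (K.map fun p => p.2.map (Prod.mk p.1)).sum

/-- Two pebbles on the base vertex of each member of a family of configurations on fibres. -/
def doubles (K : Multiset (V × Config W)) : Config V :=
  (K.map fun p => ({p.1, p.1} : Multiset V)).sum

@[simp] theorem blocks_cons (p : V × Config W) (K : Multiset (V × Config W)) :
    blocks (p ::ₘ K) = p.2.map (Prod.mk p.1) + blocks K := by simp [blocks]

@[simp] theorem doubles_cons (p : V × Config W) (K : Multiset (V × Config W)) :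
    doubles (p ::ₘ K) = {p.1, p.1} + doubles K := by simp [doubles]

theorem mem_doubles {K : Multiset (V × Config W)} {g : V} (h : g ∈ doubles K) :
    ∃ M, (g, M) ∈ K := by
  induction K using Multiset.induction_on with
  | empty => simp [doubles] at h
  | cons p K ih =>
    rw [doubles_cons] at h
    rcases Multiset.mem_add.mp h with h | h
    · have : g = p.1 := by simpa using h
      exact ⟨p.2, by simp [this]⟩
    · obtain ⟨M, hM⟩ := ih h
      exact ⟨M, Multiset.mem_cons_of_mem hM⟩

theorem card_doubles (K : Multiset (V × Config W)) :
    Multiset.card (doubles K) = 2 * Multiset.card K := by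
  induction K using Multiset.induction_on with
  | empty => simp [doubles]
  | cons p K ih => simp [ih]; ring

/-- `Represents s n D C`: the configuration `D` on the first factor is represented by pebbles
of `C` on the layer of `s`, one for each pebble, and by blocks of `n + 1` pebbles on fibres, one
for each two pebbles. -/
def Represents (s : W) (n : ℕ) (D : Config V) (C : Config (V × W)) : Prop :=
  ∃ (A : Config V) (K : Multiset (V × Config W)),
    (∀ p ∈ K, Multiset.card p.2 = n + 1) ∧ D = A + doubles K ∧
      A.map (fun g => (g, s)) + blocks K ≤ C

/-- A move in G costs either two single pebbles in the layer of s or one whole block; both produce a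
single pebble in that layer. Waste is harmless, since a representation only bounds C from below. -/
theorem Represents.move {s : W} {n : ℕ} (hn : Suffices H n) {D D' : Config V}
    {C : Config (V × W)} (h : Represents s n D C) (hm : Move G D D') :
    ∃ C', Reach (strongProd G H) C C' ∧ Represents s n D' C' := by
  classical
  obtain ⟨a, b, E, hab, rfl, rfl⟩ := hm
  obtain ⟨A, K, hK, hD, hC⟩ := h
  obtain ⟨F, rfl⟩ := Multiset.le_iff_exists_add.mp hC
  by_cases hA : 2 ≤ A.count a
  · obtain ⟨A', rfl⟩ := Multiset.le_iff_exists_add.mp (Multiset.le_count_iff_replicate_le.mp hA)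
    have hE : E = A' + doubles K := by
      have h₁ : {a, a} + E = {a, a} + (A' + doubles K) := by
        rw [Multiset.add_comm, hD, Multiset.add_assoc]; rfl
      exact Multiset.add_right_inj.mp h₁
    refine ⟨({b} + A').map (fun g => (g, s)) + blocks K + F,
      Relation.ReflTransGen.single ⟨(a, s), (b, s),
        A'.map (fun g => (g, s)) + blocks K + F, Or.inr (Or.inl ⟨rfl, hab⟩), ?_, ?_⟩,
      {b} + A', K, hK, ?_, Multiset.le_add_right _ _⟩
    · simp [Multiset.replicate_succ, Multiset.insert_eq_cons]
      rw [← Multiset.singleton_add, Multiset.add_comm {(a, s)}]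
    · simp [Multiset.add_comm]
    · rw [hE]; abel
  -- `A` has at most one pebble on a, but the move needs two, so some block lies over a.
  · have ha : a ∈ doubles K := by
      have h₁ := congrArg (Multiset.count a) hD
      rw [Multiset.count_add, Multiset.count_add] at h₁
      have h₂ : Multiset.count a ({a, a} : Multiset V) = 2 := by
        simp [Multiset.insert_eq_cons]
      exact Multiset.count_pos.mp (by omega)
    obtain ⟨M, hM⟩ := mem_doubles ha
    obtain ⟨K', rfl⟩ := Multiset.exists_cons_of_mem hM
    have hE : E = A + doubles K' := by
      have h₁ : {a, a} + E = {a, a} + (A + doubles K') := by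
        rw [Multiset.add_comm, hD, doubles_cons]; abel
      exact Multiset.add_right_inj.mp h₁
    obtain ⟨R, hR⟩ := hn.fiber_reach_adj s (hK _ hM) hab
    refine ⟨_, ?_, {b} + A, K', fun p hp => hK p (Multiset.mem_cons_of_mem hp), ?_,
      Multiset.le_add_right _ (R + F)⟩
    · convert hR.add_right (A.map (fun g => (g, s)) + blocks K' + F) using 1
      · rw [blocks_cons]; abel
      · rw [Multiset.map_add, Multiset.map_singleton]; abel
    · rw [hE]; abel

theorem Represents.reach {s : W} {n : ℕ} (hn : Suffices H n) {D D' : Config V}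
    {C : Config (V × W)} (h : Represents s n D C) (hr : Reach G D D') :
    ∃ C', Reach (strongProd G H) C C' ∧ Represents s n D' C' := by
  induction hr with
  | refl => exact ⟨C, Relation.ReflTransGen.refl, h⟩
  | tail _ hm ih =>
    obtain ⟨C₁, h₁, hC₁⟩ := ih
    obtain ⟨C₂, h₂, hC₂⟩ := hC₁.move hn hm
    exact ⟨C₂, h₁.trans h₂, hC₂⟩

/-- A represented pebble on r is either a real one on (r, s) or half of a block over r, and that
block reaches s inside its own fibre. -/
theorem Represents.solvable_of_mem {s : W} {n : ℕ} (hn : Suffices H n) {D : Config V}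
    {C : Config (V × W)} (h : Represents s n D C) {r : V} (hr : r ∈ D) :
    Solvable (strongProd G H) (r, s) C := by
  obtain ⟨A, K, hK, rfl, hC⟩ := h
  rcases Multiset.mem_add.mp hr with hA | hd
  · refine ⟨C, Relation.ReflTransGen.refl, Multiset.mem_of_le hC ?_⟩
    exact Multiset.mem_add.mpr (Or.inl (Multiset.mem_map_of_mem (fun g => (g, s)) hA))
  · obtain ⟨M, hM⟩ := mem_doubles hd
    obtain ⟨K', rfl⟩ := Multiset.exists_cons_of_mem hM
    obtain ⟨E, hE, hs⟩ := hn.solvable s (C := M) (by have := hK _ hM; simp at this; omega)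
    have h₁ : Solvable (strongProd G H) (r, s) (M.map (Prod.mk r)) :=
      ⟨_, hE.fiber r, Multiset.mem_map_of_mem _ hs⟩
    refine h₁.mono (le_trans ?_ hC)
    rw [blocks_cons]
    exact (Multiset.le_add_right _ _).trans (Multiset.le_add_left _ _)

theorem Represents.solvable {s : W} {n : ℕ} (hn : Suffices H n) {D : Config V}
    {C : Config (V × W)} (h : Represents s n D C) {r : V} (hr : Solvable G r D) :
    Solvable (strongProd G H) (r, s) C := by
  obtain ⟨D', hD', hrD'⟩ := hr
  obtain ⟨C', hC', h'⟩ := h.reach hn hD'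
  obtain ⟨C'', hC'', hmem⟩ := h'.solvable_of_mem (G := G) hn hrD'
  exact ⟨C'', hC'.trans hC'', hmem⟩

/-- A configuration on the product contains blocks of `n + 1` pebbles on fibres such that at most
`n` pebbles of each fibre are left over. -/
theorem exists_blocks [Fintype V] (n : ℕ) (C : Config (V × W)) :
    ∃ K : Multiset (V × Config W), (∀ p ∈ K, Multiset.card p.2 = n + 1) ∧ blocks K ≤ C ∧
      Multiset.card C ≤ Multiset.card K * (n + 1) + Fintype.card V * n := by
  classical
  induction hc : Multiset.card C using Nat.strong_induction_on generalizing C with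
  | _ c ih =>
    by_cases hle : c ≤ Fintype.card V * n
    · exact ⟨0, by simp, by simp [blocks], by simpa using hle⟩
    -- Pigeonhole: some fibre still holds a full block; remove it and recurse.
    · obtain ⟨g, -, hg⟩ : ∃ g ∈ (Finset.univ : Finset V), n < (C.map Prod.fst).count g := by
        refine Finset.exists_lt_of_sum_lt ?_
        rw [Multiset.sum_count_eq_card (fun x _ => Finset.mem_univ x)]
        simpa [hc] using hle
      rw [Multiset.count_map] at hg
      obtain ⟨B, hB, hBn⟩ := exists_le_card_eq (Nat.succ_le_of_lt hg)
      obtain ⟨C', rfl⟩ := Multiset.le_iff_exists_add.mp (hB.trans (Multiset.filter_le _ _))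
      rw [Multiset.card_add, hBn] at hc
      obtain ⟨K, hK, hKC, hcard⟩ := ih _ (by omega) C' rfl
      have hB' : (B.map Prod.snd).map (Prod.mk g) = B := by
        rw [Multiset.map_map]
        conv_rhs => rw [← Multiset.map_id B]
        refine Multiset.map_congr rfl fun x hx => ?_
        have := (Multiset.mem_filter.mp (Multiset.mem_of_le hB hx)).2
        simp [this]
      refine ⟨(g, B.map Prod.snd) ::ₘ K, ?_, ?_, ?_⟩
      · intro p hp
        rcases Multiset.mem_cons.mp hp with rfl | hp
        · simpa using hBn
        · exact hK p hp
      · rw [blocks_cons]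
        simp only [hB']
        exact add_le_add_right hKC B
      · rw [Multiset.card_cons, Nat.succ_mul]
        omega

theorem Suffices.strongProd [Fintype V] [Nonempty V] {m n N : ℕ} (hm : Suffices G m)
    (hn : Suffices H n) (hN : (m + 2 * Fintype.card V + 1) * (n + 1) ≤ 2 * N + 1) :
    Suffices (strongProd G H) N := by
  rintro ⟨r, s⟩ C rfl
  obtain ⟨K, hK, hKC, hcard⟩ := exists_blocks n C
  refine Represents.solvable hn (D := doubles K)
    ⟨0, K, hK, by simp, by simpa using hKC⟩ (hm.solvable r ?_)
  rw [card_doubles]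
  have hV : 0 < Fintype.card V := Fintype.card_pos
  refine Nat.le_of_mul_le_mul_right ?_ (Nat.succ_pos n)
  change m * (n + 1) ≤ 2 * Multiset.card K * (n + 1)
  -- The bounds give 2|K|(n + 1) ≥ m(n + 1) + 2|V| + n, so the 1 conceded in `hN` is affordable.
  nlinarith

end Pebbling

theorem proposition4p3 {V : Type*} {W : Type*} [Fintype V] [Fintype W]
    (G : SimpleGraph V) (H : SimpleGraph W) (hG : G.Connected) (hH : H.Connected) :
    (Pebbling.pebblingNumber (Pebbling.strongProd G H) : ℝ) ≤
      1 / 2 * ((Pebbling.pebblingNumber G : ℝ) + 2 * (Fintype.card V : ℝ) + 1) *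
        ((Pebbling.pebblingNumber H : ℝ) + 1) := by
  have : Nonempty V := hG.nonempty
  set P := (Pebbling.pebblingNumber G + 2 * Fintype.card V + 1) *
    (Pebbling.pebblingNumber H + 1) with hP
  -- The `+ 1` in `Suffices.strongProd` absorbs the rounding of `P / 2` when `P` is odd.
  have hle : Pebbling.pebblingNumber (Pebbling.strongProd G H) ≤ P / 2 :=
    (Pebbling.isLeast_pebblingNumber (Pebbling.strongProd_connected hG hH)).2
      ((Pebbling.isLeast_pebblingNumber hG).1.strongProd
        (Pebbling.isLeast_pebblingNumber hH).1 (by omega))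
  have h₁ : 2 * Pebbling.pebblingNumber (Pebbling.strongProd G H) ≤ P := by omega
  have h₂ : (2 * Pebbling.pebblingNumber (Pebbling.strongProd G H) : ℝ) ≤ P := by
    exact_mod_cast h₁
  rw [hP] at h₂
  push_cast at h₂
  linarith
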